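/- Let $\mathcal R$ be a commutative unital ring and let $R$ be a commutative unital $\mathcal R$-algebra that is generated, as an $\mathcal R$-algebra, by its set $E(R)$ of idempotents and is torsion-free, meaning that $ae\neq 0$ whenever $0\neq a\in\mathcal R$ and $0\neq e\in E(R)$. Recall that $E(R)$ is a Boolean algebra with $e\wedge f=ef$, $e\vee f=e+f-ef$, $\neg e=1-e$. Let $X(R)$ be its Stone dual, i.e. the set of ultrafilters of $E(R)$ with the topology that has the sets $Z_e=\{\mathcal F: e\in\mathcal F\}$, $e\in E(R)$, as a basis. For a subset $U$ of $X(R)$ that is compact and open, let $\mathcal L_c(U,\mathcal R)$ be the algebra of locally constant functions $U\to\mathcal R$ with compact support, identified with the ideal of those functions in $\mathcal L_c(X(R),\mathcal R)$ that vanish outside $U$. Let $G$ be a (small) groupoid, with range map $r$. A partial action of $G$ on a set $Y$ is a family $(Y_g,\alpha_g)_{g\in G}$ of subsets $Y_g\subseteq Y$ and bijections $\alpha_g:Y_{g^{-1}}\to Y_g$ such that $Y_g\subseteq Y_{r(g)}$ for all $g$, $\alpha_e=\mathrm{id}_{Y_e}$ for all identities $e$, and, whenever $gh$ is defined, $\alpha_h^{-1}(Y_{g^{-1}}\cap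 Y_h)\subseteq Y_{(gh)^{-1}}$ and $\alpha_g(\alpha_h(x))=\alpha_{gh}(x)$ for all $x\in\alpha_h^{-1}(Y_{g^{-1}}\cap Y_h)$. It is a topological partial action on a space $Y$ if all $Y_g$ are open and all $\alpha_g$ are homeomorphisms; it is a partial action on an $\mathcal R$-algebra $Y$ if $Y_{r(g)}$ is an ideal of $Y$, $Y_g$ is an ideal of $Y_{r(g)}$ and $\alpha_g$ is an isomorphism of $\mathcal R$-algebras, for all $g$. Let $\tau=(D_g,\tau_g)_{g\in G}$ be a partial action of $G$ on the $\mathcal R$-algebra $R$ such that every $D_g$ has an identity element $u_g$. Put $U_g:=Z_{u_g}$ and, for $\mathcal F\in U_{g^{-1}}$, let $\theta_g(\mathcal F)$ be the set of all $y\in E(R)$ such that $z\le y$ for some idempotent $z\in D_g$ with $\tau_{g^{-1}}(z)\in\{u_{g^{-1}}x: x\in\mathcal F\}$; this is an ultrafilter of $E(R)$. For $f\in\mathcal L_c(U_{g^{-1}},\mathcal R)$ put $\rho_g(f):=f\circ\theta_{g^{-1}}\in\mathcal L_c(U_g,\mathcal R)$. Then: 1. $\theta=(U_g,\theta_g)_{g\in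 G}$ is a topological partial action of $G$ on $X(R)$; 2. $\rho=(\mathcal L_c(U_g,\mathcal R),\rho_g)_{g\in G}$ is a partial action of $G$ on the $\mathcal R$-algebra $\mathcal L_c(X(R),\mathcal R)$; 3. $\tau$ and $\rho$ are $G$-equivariantly isomorphic: there is an isomorphism of $\mathcal R$-algebras $\varphi:R\to\mathcal L_c(X(R),\mathcal R)$, with $\varphi(e)=1_{Z_e}$ for all $e\in E(R)$, such that $\varphi(D_g)=\mathcal L_c(U_g,\mathcal R)$ and $\varphi(\tau_g(x))=\rho_g(\varphi(x))$ for all $g\in G$ and $x\in D_{g^{-1}}$. -/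

import Mathlib

open CategoryTheory

universe v u

/-! ### Partial actions of a groupoid

A small groupoid is given by its type `G` of objects together with `[Groupoid G]`; an element of the
groupoid is a morphism `g : a ⟶ b`, with source `a`, range `b`, and the object `e` is identified with
`𝟙 e`.  The product `gh` (defined when the source of `g` is the range of `h`) is `h ≫ g`. -/

/-- A family of pairs `(X_g, α_g)`, indexed by the elements `g` of the groupoid, where `X_g = dom g`
is a subset of `X` and `α_g` is the map `map g`, considered on `X_{g⁻¹}` only; the values of `map g`
outside of `dom (Groupoid.inv g)` are irrelevant and never used. -/
structure PartialFamily (G : Type u) [Groupoid.{v} G] (X : Type*) where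
  dom : ∀ {a b : G}, (a ⟶ b) → Set X
  map : ∀ {a b : G}, (a ⟶ b) → X → X

/-- The family `(X_g, α_g)` is a partial action of the groupoid `G` on the set `X`. -/
structure IsPartialAction {G : Type u} [Groupoid.{v} G] {X : Type*} (α : PartialFamily G X) :
    Prop where
  bijOn : ∀ {a b : G} (g : a ⟶ b), Set.BijOn (α.map g) (α.dom (Groupoid.inv g)) (α.dom g)
  dom_subset : ∀ {a b : G} (g : a ⟶ b), α.dom g ⊆ α.dom (𝟙 b)
  map_id : ∀ (e : G), ∀ x ∈ α.dom (𝟙 e), α.map (𝟙 e) x = x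
  dom_comp : ∀ {a b c : G} (h : a ⟶ b) (g : b ⟶ c), ∀ x ∈ α.dom (Groupoid.inv h),
    α.map h x ∈ α.dom (Groupoid.inv g) ∩ α.dom h → x ∈ α.dom (Groupoid.inv (h ≫ g))
  map_comp : ∀ {a b c : G} (h : a ⟶ b) (g : b ⟶ c), ∀ x ∈ α.dom (Groupoid.inv h),
    α.map h x ∈ α.dom (Groupoid.inv g) ∩ α.dom h → α.map g (α.map h x) = α.map (h ≫ g) x

/-- The family is a topological partial action: every `X_g` is open and every
`α_g : X_{g⁻¹} → X_g` is a homeomorphism. -/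
structure IsTopologicalPartialAction {G : Type u} [Groupoid.{v} G] {X : Type*}
    [TopologicalSpace X] (α : PartialFamily G X) : Prop extends IsPartialAction α where
  isOpen_dom : ∀ {a b : G} (g : a ⟶ b), IsOpen (α.dom g)
  isHomeomorph : ∀ {a b : G} (g : a ⟶ b),
    IsHomeomorph ((bijOn g).mapsTo.restrict (α.map g) (α.dom (Groupoid.inv g)) (α.dom g))

/-- `I` is a (two-sided) ideal of the subalgebra `J` of the `K`-algebra `A`. -/
structure IsIdealOf (K : Type*) [CommRing K] {A : Type*} [NonUnitalRing A] [Module K A]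
    (I J : Set A) : Prop where
  subset : I ⊆ J
  zero_mem : (0 : A) ∈ I
  add_mem : ∀ x ∈ I, ∀ y ∈ I, x + y ∈ I
  smul_mem : ∀ (r : K), ∀ x ∈ I, r • x ∈ I
  mul_mem : ∀ x ∈ I, ∀ y ∈ J, x * y ∈ I ∧ y * x ∈ I

/-- The family is a partial action of the groupoid `G` on the (not necessarily unital) `K`-algebra
`A`: a partial action on the set `A` such that `D_{r(g)}` is an ideal of `A`, `D_g` is an ideal of
`D_{r(g)}`, and `α_g : D_{g⁻¹} → D_g` is an isomorphism of `K`-algebras. -/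
structure IsAlgPartialAction (K : Type*) [CommRing K] {G : Type u} [Groupoid.{v} G] {A : Type*}
    [NonUnitalRing A] [Module K A] (α : PartialFamily G A) : Prop extends IsPartialAction α where
  ideal_id : ∀ e : G, IsIdealOf K (α.dom (𝟙 e)) Set.univ
  ideal_dom : ∀ {a b : G} (g : a ⟶ b), IsIdealOf K (α.dom g) (α.dom (𝟙 b))
  map_add : ∀ {a b : G} (g : a ⟶ b), ∀ x ∈ α.dom (Groupoid.inv g), ∀ y ∈ α.dom (Groupoid.inv g),
    α.map g (x + y) = α.map g x + α.map g y
  map_mul : ∀ {a b : G} (g : a ⟶ b), ∀ x ∈ α.dom (Groupoid.inv g), ∀ y ∈ α.dom (Groupoid.inv g),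
    α.map g (x * y) = α.map g x * α.map g y
  map_smul : ∀ {a b : G} (g : a ⟶ b) (r : K), ∀ x ∈ α.dom (Groupoid.inv g),
    α.map g (r • x) = r • α.map g x

/-- `w` is a multiplicative identity element of the set `D`. -/
structure IsIdentityOf {A : Type*} [Mul A] (w : A) (D : Set A) : Prop where
  mem : w ∈ D
  mul_left : ∀ x ∈ D, w * x = x
  mul_right : ∀ x ∈ D, x * w = x

/-- `φ` is a `G`-equivariant isomorphism between the partial actions `α` on the `K`-algebra `A` and
`β` on the `K`-algebra `B`: it is `K`-linear, maps `A_g` onto `B_g`, and `φ ∘ α_g = β_g ∘ φ`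
on `A_{g⁻¹}`. -/
structure IsEquivariantIso (K : Type*) [CommRing K] {G : Type u} [Groupoid.{v} G] {A B : Type*}
    [NonUnitalRing A] [Module K A] [NonUnitalRing B] [Module K B]
    (α : PartialFamily G A) (β : PartialFamily G B) (φ : A ≃+* B) : Prop where
  map_smul : ∀ (r : K) (x : A), φ (r • x) = r • φ x
  image_dom : ∀ {a b : G} (g : a ⟶ b), φ '' α.dom g = β.dom g
  map_map : ∀ {a b : G} (g : a ⟶ b), ∀ x ∈ α.dom (Groupoid.inv g), φ (α.map g x) = β.map g (φ x)

/-! ### The Stone dual of a Boolean algebra -/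

/-- The Stone dual of a Boolean algebra: the set of its ultrafilters (maximal proper filters). -/
def StoneDual (B : Type*) [BooleanAlgebra B] : Type _ :=
  {F : Order.PFilter B // Maximal (fun F' : Order.PFilter B => ⊥ ∉ F') F}

namespace StoneDual

section Basic

variable {B : Type*} [BooleanAlgebra B]

/-- The basic set `Z_e` of the ultrafilters that contain `e`. -/
def Z (e : B) : Set (StoneDual B) := {F | e ∈ F.1}

/-- The topology with the basis `{Z_e}`. -/
instance : TopologicalSpace (StoneDual B) :=
  TopologicalSpace.generateFrom {U | ∃ e : B, U = Z e}

theorem isPFilter_of {S : Set B} (top : ⊤ ∈ S) (inf : ∀ x ∈ S, ∀ y ∈ S, x ⊓ y ∈ S)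
    (up : ∀ x y, x ≤ y → x ∈ S → y ∈ S) : Order.IsPFilter S :=
  Order.IsPFilter.of_def ⟨⊤, top⟩
    (fun x hx y hy => ⟨x ⊓ y, inf x hx y hy, inf_le_left, inf_le_right⟩)
    (fun {x y} h hx => up x y h hx)

theorem compl_mem_of_notMem (F : StoneDual B) {e : B} (he : e ∉ F.1) : eᶜ ∈ F.1 := by
  have hS : Order.IsPFilter {y : B | ∃ x ∈ F.1, x ⊓ e ≤ y} := by
    refine isPFilter_of ⟨⊤, Order.PFilter.top_mem, le_top⟩ ?_ ?_
    · rintro x ⟨a, ha, hax⟩ y ⟨b, hb, hby⟩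
      refine ⟨a ⊓ b, Order.PFilter.inf_mem ha hb, le_inf (le_trans ?_ hax) (le_trans ?_ hby)⟩
      · exact inf_le_inf_right _ inf_le_left
      · exact inf_le_inf_right _ inf_le_right
    · rintro x y hxy ⟨a, ha, hax⟩
      exact ⟨a, ha, hax.trans hxy⟩
  have hmem : ∀ y, y ∈ hS.toPFilter ↔ ∃ x ∈ F.1, x ⊓ e ≤ y := fun y => Iff.rfl
  by_cases hb : ⊥ ∈ hS.toPFilter
  · obtain ⟨x, hx, hxe⟩ := (hmem ⊥).1 hb
    exact Order.PFilter.mem_of_le (le_compl_iff_disjoint_right.2 (disjoint_iff_inf_le.2 hxe)) hx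
  · have hle : F.1 ≤ hS.toPFilter := fun x hx => (hmem x).2 ⟨x, hx, inf_le_left⟩
    exact absurd (F.2.2 hb hle ((hmem e).2 ⟨⊤, Order.PFilter.top_mem, inf_le_right⟩)) he

theorem compl_mem_iff (F : StoneDual B) {e : B} : eᶜ ∈ F.1 ↔ e ∉ F.1 := by
  refine ⟨fun h he => F.2.1 ?_, F.compl_mem_of_notMem⟩
  have := Order.PFilter.inf_mem he h
  rwa [inf_compl_self] at this

/-- An ultrafilter, from a subset that has the defining properties in their prime form. -/
def ofSet (S : Set B) (top : ⊤ ∈ S) (inf : ∀ x ∈ S, ∀ y ∈ S, x ⊓ y ∈ S)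
    (up : ∀ x y, x ≤ y → x ∈ S → y ∈ S) (bot : ⊥ ∉ S) (compl : ∀ x, x ∈ S ∨ xᶜ ∈ S) :
    StoneDual B :=
  ⟨(isPFilter_of top inf up).toPFilter, bot, by
    intro F hF hle x hx
    rcases compl x with h | h
    · exact h
    · have := Order.PFilter.inf_mem hx (hle h)
      rw [inf_compl_self] at this
      exact absurd this hF⟩

theorem isOpen_Z (e : B) : IsOpen (Z e) := TopologicalSpace.isOpen_generateFrom_of_mem ⟨e, rfl⟩

theorem isClosed_Z (e : B) : IsClosed (Z e) := by
  have : (Z e)ᶜ = Z eᶜ := by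
    ext F; exact (F.compl_mem_iff).symm
  rw [← isOpen_compl_iff, this]
  exact isOpen_Z _

instance : CompactSpace (StoneDual B) := by
  refine ⟨isCompact_iff_ultrafilter_le_nhds.2 fun f _ => ?_⟩
  have key : ∀ e : B, (Z eᶜ : Set (StoneDual B)) = (Z e)ᶜ := fun e => by
    ext F; exact F.compl_mem_iff
  refine ⟨ofSet {e | Z e ∈ f} ?_ ?_ ?_ ?_ ?_, Set.mem_univ _, ?_⟩
  · exact Filter.mem_of_superset Filter.univ_mem fun F _ => Order.PFilter.top_mem
  · intro x hx y hy
    exact Filter.mem_of_superset (Filter.inter_mem hx hy)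
      fun F hF => Order.PFilter.inf_mem hF.1 hF.2
  · intro x y hxy hx
    exact Filter.mem_of_superset hx fun F hF => Order.PFilter.mem_of_le hxy hF
  · intro (h : Z ⊥ ∈ f)
    have : (Z (⊥ : B)) = ∅ := Set.eq_empty_of_forall_notMem fun F hF => F.2.1 hF
    rw [this] at h
    exact f.empty_notMem h
  · intro x
    change Z x ∈ f ∨ Z xᶜ ∈ f
    rw [key]
    exact f.mem_or_compl_mem _
  · rw [TopologicalSpace.nhds_generateFrom]
    refine le_iInf₂ fun U hU => ?_
    obtain ⟨hFU, e, rfl⟩ := hU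
    exact Filter.le_principal_iff.2 hFU

theorem isLocallyConstant_of {Y : Type*} {f : StoneDual B → Y}
    (h : ∀ F, ∃ U, IsOpen U ∧ F ∈ U ∧ ∀ F' ∈ U, f F' = f F) : IsLocallyConstant f :=
  (IsLocallyConstant.iff_exists_open f).2 h

theorem exists_Z_subset {U : Set (StoneDual B)} (hU : IsOpen U) {F : StoneDual B} (hF : F ∈ U) :
    ∃ e, F ∈ Z e ∧ Z e ⊆ U := by
  induction hU with
  | basic s hs => obtain ⟨e, rfl⟩ := hs; exact ⟨e, hF, subset_rfl⟩
  | univ => exact ⟨⊤, Order.PFilter.top_mem, Set.subset_univ _⟩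
  | inter s t _ _ hs ht =>
    obtain ⟨e, he, hes⟩ := hs hF.1
    obtain ⟨e', he', het⟩ := ht hF.2
    refine ⟨e ⊓ e', Order.PFilter.inf_mem he he', fun F' hF' => ⟨hes ?_, het ?_⟩⟩
    · exact Order.PFilter.mem_of_le inf_le_left hF'
    · exact Order.PFilter.mem_of_le inf_le_right hF'
  | sUnion S _ ih =>
    obtain ⟨s, hs, hFs⟩ := hF
    obtain ⟨e, he, hes⟩ := ih s hs hFs
    exact ⟨e, he, hes.trans (Set.subset_sUnion_of_mem hs)⟩

end Basic

end StoneDual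

/-! ### Locally constant functions with compact support -/

/-- The `K`-algebra of the locally constant functions `X → K` with compact support. -/
def Lc (X : Type*) [TopologicalSpace X] (K : Type*) [CommRing K] :
    NonUnitalSubalgebra K (X → K) where
  carrier := {f | IsLocallyConstant f ∧ HasCompactSupport f}
  add_mem' := fun hf hg => ⟨hf.1.add hg.1, hf.2.add hg.2⟩
  zero_mem' := ⟨IsLocallyConstant.const 0, HasCompactSupport.zero⟩
  mul_mem' := fun hf hg => ⟨hf.1.mul hg.1, hf.2.mul_right⟩
  smul_mem' := fun c _ hf => ⟨hf.1.comp (fun y => c • y),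
    hf.2.comp_left (g := fun y => c • y) (smul_zero c)⟩

/-! ### The partial actions induced on the Stone dual and on the locally constant functions -/

/-- The set `E(R)` of the idempotents of `R`, a Boolean algebra with `e ∧ f = ef`,
`e ∨ f = e + f - ef`, `¬ e = 1 - e`, and `e ≤ f` if and only if `ef = e`. -/
abbrev Idem (R : Type*) [CommRing R] : Type _ := {e : R // IsIdempotentElem e}

namespace PartialFamily

section Induced

variable {K : Type*} [CommRing K] {R : Type*} [CommRing R] [Algebra K R]
  {G : Type u} [Groupoid.{v} G] {τ : PartialFamily G R} {w : ∀ {a b : G}, (a ⟶ b) → R}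

/-- The identity element of `D_g` as an element of `E(R)`. -/
def identityIdem (hw : ∀ {a b : G} (g : a ⟶ b), IsIdentityOf (w g) (τ.dom g)) {a b : G}
    (g : a ⟶ b) : Idem R :=
  ⟨w g, (hw g).mul_left _ (hw g).mem⟩

/-- `θ_g(F)` as a subset of `E(R)`: the upward closure in `E(R)` of the set of those
`z ∈ E(D_g)` that `τ_{g⁻¹}` maps into `{u_{g⁻¹} x : x ∈ F}`. -/
def thetaSet (τ : PartialFamily G R) (w : ∀ {a b : G}, (a ⟶ b) → R) {a b : G} (g : a ⟶ b)
    (F : StoneDual (Idem R)) : Set (Idem R) :=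
  {y | ∃ z : Idem R, z.1 ∈ τ.dom g ∧ z ≤ y ∧
    ∃ x ∈ F.1, τ.map (Groupoid.inv g) z.1 = w (Groupoid.inv g) * x.1}

theorem bijOn_tauInv (hτ : IsPartialAction τ) {a b : G} (g : a ⟶ b) :
    Set.BijOn (τ.map (Groupoid.inv g)) (τ.dom g) (τ.dom (Groupoid.inv g)) := by
  have h := hτ.bijOn (Groupoid.inv g)
  have e : Groupoid.inv (Groupoid.inv g) = g := by simp
  rwa [e] at h

theorem tauInv_mul (hτ : IsAlgPartialAction K τ) {a b : G} (g : a ⟶ b) {x y : R}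
    (hx : x ∈ τ.dom g) (hy : y ∈ τ.dom g) : τ.map (Groupoid.inv g) (x * y) =
      τ.map (Groupoid.inv g) x * τ.map (Groupoid.inv g) y := by
  have h := hτ.map_mul (Groupoid.inv g)
  have e : Groupoid.inv (Groupoid.inv g) = g := by simp
  rw [e] at h
  exact h x hx y hy

theorem tauInv_add (hτ : IsAlgPartialAction K τ) {a b : G} (g : a ⟶ b) {x y : R}
    (hx : x ∈ τ.dom g) (hy : y ∈ τ.dom g) : τ.map (Groupoid.inv g) (x + y) =
      τ.map (Groupoid.inv g) x + τ.map (Groupoid.inv g) y := by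
  have h := hτ.map_add (Groupoid.inv g)
  have e : Groupoid.inv (Groupoid.inv g) = g := by simp
  rw [e] at h
  exact h x hx y hy

theorem identity_mul_mem (hτ : IsAlgPartialAction K τ)
    (hw : ∀ {a b : G} (g : a ⟶ b), IsIdentityOf (w g) (τ.dom g)) {a b : G} (g : a ⟶ b) (y : R) :
    w g * y ∈ τ.dom g := by
  have h1 : w g * y ∈ τ.dom (𝟙 b) :=
    ((hτ.ideal_id b).mul_mem _ (hτ.dom_subset g (hw g).mem) y (Set.mem_univ _)).1
  have h2 := ((hτ.ideal_dom g).mul_mem _ (hw g).mem _ h1).1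
  rwa [← mul_assoc, (hw g).mul_left _ (hw g).mem] at h2

/-- The element `τ_{g⁻¹}(u_g y)` of `E(R)`, for `y ∈ E(R)`. -/
def pullIdem (hτ : IsAlgPartialAction K τ)
    (hw : ∀ {a b : G} (g : a ⟶ b), IsIdentityOf (w g) (τ.dom g)) {a b : G} (g : a ⟶ b)
    (y : Idem R) : Idem R :=
  ⟨τ.map (Groupoid.inv g) (w g * y.1), by
    have hm := identity_mul_mem hτ hw g y.1
    rw [IsIdempotentElem, ← tauInv_mul hτ g hm hm]
    congr 1
    exact ((identityIdem hw g).2.mul y.2 : IsIdempotentElem (w g * y.1))⟩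

theorem tauInv_identity (hτ : IsAlgPartialAction K τ)
    (hw : ∀ {a b : G} (g : a ⟶ b), IsIdentityOf (w g) (τ.dom g)) {a b : G} (g : a ⟶ b) :
    τ.map (Groupoid.inv g) (w g) = w (Groupoid.inv g) := by
  have hb := bijOn_tauInv hτ.toIsPartialAction g
  obtain ⟨x, hx, hxw⟩ := hb.surjOn (hw (Groupoid.inv g)).mem
  have h1 : τ.map (Groupoid.inv g) (w g) * w (Groupoid.inv g) = w (Groupoid.inv g) := by
    rw [← hxw, ← tauInv_mul hτ g (hw g).mem hx, (hw g).mul_left x hx]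
  rw [← h1, (hw (Groupoid.inv g)).mul_right _ (hb.mapsTo (hw g).mem)]

theorem mem_thetaSet_iff (hτ : IsAlgPartialAction K τ)
    (hw : ∀ {a b : G} (g : a ⟶ b), IsIdentityOf (w g) (τ.dom g)) {a b : G} (g : a ⟶ b)
    {F : StoneDual (Idem R)} (hF : F ∈ StoneDual.Z (identityIdem hw (Groupoid.inv g)))
    (y : Idem R) : y ∈ thetaSet τ w g F ↔ pullIdem hτ hw g y ∈ F.1 := by
  have hm := identity_mul_mem hτ hw g y.1
  constructor
  · rintro ⟨z, hz, hzy, x, hx, hzx⟩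
    have hzy' : z.1 * y.1 = z.1 := hzy
    refine Order.PFilter.mem_of_le ?_ (Order.PFilter.inf_mem hF hx)
    change w (Groupoid.inv g) * x.1 * τ.map (Groupoid.inv g) (w g * y.1)
      = w (Groupoid.inv g) * x.1
    rw [← hzx, ← tauInv_mul hτ g hz hm, ← mul_assoc, (hw g).mul_right _ hz, hzy']
  · intro h
    refine ⟨identityIdem hw g ⊓ y, hm, inf_le_right, _, h, ?_⟩
    exact ((hw (Groupoid.inv g)).mul_left _
      ((bijOn_tauInv hτ.toIsPartialAction g).mapsTo hm)).symm

/-- The ultrafilter `θ_g(F)`, for `F ∈ U_{g⁻¹}`. -/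
def thetaFilter (hτ : IsAlgPartialAction K τ)
    (hw : ∀ {a b : G} (g : a ⟶ b), IsIdentityOf (w g) (τ.dom g)) {a b : G} (g : a ⟶ b)
    (F : StoneDual (Idem R)) (hF : F ∈ StoneDual.Z (identityIdem hw (Groupoid.inv g))) :
    StoneDual (Idem R) :=
  StoneDual.ofSet (thetaSet τ w g F)
    (by
      rw [mem_thetaSet_iff hτ hw g hF]
      have : pullIdem hτ hw g ⊤ = identityIdem hw (Groupoid.inv g) := Subtype.ext (by
        change τ.map (Groupoid.inv g) (w g * 1) = w (Groupoid.inv g)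
        rw [mul_one, tauInv_identity hτ hw])
      rw [this]
      exact hF)
    (by
      intro x hx y hy
      rw [mem_thetaSet_iff hτ hw g hF] at *
      have : pullIdem hτ hw g (x ⊓ y) = pullIdem hτ hw g x ⊓ pullIdem hτ hw g y :=
        Subtype.ext (by
          change τ.map (Groupoid.inv g) (w g * (x.1 * y.1))
            = τ.map (Groupoid.inv g) (w g * x.1) * τ.map (Groupoid.inv g) (w g * y.1)
          rw [← tauInv_mul hτ g (identity_mul_mem hτ hw g _) (identity_mul_mem hτ hw g _),
            mul_mul_mul_comm, (hw g).mul_left _ (hw g).mem])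
      rw [this]
      exact Order.PFilter.inf_mem hx hy)
    (fun x y hxy ⟨z, hz, hzx, h⟩ => ⟨z, hz, hzx.trans hxy, h⟩)
    (by
      rw [mem_thetaSet_iff hτ hw g hF]
      have : pullIdem hτ hw g ⊥ = ⊥ := Subtype.ext (by
        change τ.map (Groupoid.inv g) (w g * 0) = 0
        have h0 : (0 : R) ∈ τ.dom g := (hτ.ideal_dom g).zero_mem
        have := tauInv_add hτ g h0 h0
        rw [add_zero] at this
        rw [mul_zero]
        exact left_eq_add.1 this)
      rw [this]
      exact F.2.1)
    (by
      intro x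
      rw [mem_thetaSet_iff hτ hw g hF, mem_thetaSet_iff hτ hw g hF]
      by_cases hx : pullIdem hτ hw g x ∈ F.1
      · exact Or.inl hx
      · right
        have h := Order.PFilter.inf_mem hF (F.compl_mem_of_notMem hx)
        have e : identityIdem hw (Groupoid.inv g) ⊓ (pullIdem hτ hw g x)ᶜ
            = pullIdem hτ hw g xᶜ := Subtype.ext (by
          change w (Groupoid.inv g) * (1 - τ.map (Groupoid.inv g) (w g * x.1))
            = τ.map (Groupoid.inv g) (w g * (1 - x.1))
          have hadd := tauInv_add hτ g (identity_mul_mem hτ hw g x.1)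
            (identity_mul_mem hτ hw g (1 - x.1))
          rw [← mul_add, add_sub_cancel, mul_one, tauInv_identity hτ hw] at hadd
          rw [mul_sub, mul_one, (hw (Groupoid.inv g)).mul_left _
            ((bijOn_tauInv hτ.toIsPartialAction g).mapsTo (identity_mul_mem hτ hw g x.1))]
          exact sub_eq_of_eq_add' hadd)
        exact e ▸ h)

open Classical in
/-- The family `θ = (U_g, θ_g)` on the Stone dual `X(R)` of `E(R)`, with `U_g = Z_{u_g}`. -/
noncomputable def stoneFamily (hτ : IsAlgPartialAction K τ)
    (hw : ∀ {a b : G} (g : a ⟶ b), IsIdentityOf (w g) (τ.dom g)) :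
    PartialFamily G (StoneDual (Idem R)) where
  dom g := StoneDual.Z (identityIdem hw g)
  map g F := if hF : F ∈ StoneDual.Z (identityIdem hw (Groupoid.inv g)) then
    thetaFilter hτ hw g F hF else F

open Classical in
theorem pullback_mem_Lc (hτ : IsAlgPartialAction K τ)
    (hw : ∀ {a b : G} (g : a ⟶ b), IsIdentityOf (w g) (τ.dom g)) {a b : G} (g : a ⟶ b)
    (f : Lc (StoneDual (Idem R)) K) :
    (fun F => if F ∈ (stoneFamily hτ hw).dom g then
      f.1 ((stoneFamily hτ hw).map (Groupoid.inv g) F) else 0) ∈ Lc (StoneDual (Idem R)) K := by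
  refine ⟨StoneDual.isLocallyConstant_of fun F => ?_, HasCompactSupport.of_compactSpace _⟩
  have e : Groupoid.inv (Groupoid.inv g) = g := by simp
  have hZ : StoneDual.Z (identityIdem hw g)
      = StoneDual.Z (identityIdem hw (Groupoid.inv (Groupoid.inv g))) := by rw [e]
  by_cases hF : F ∈ StoneDual.Z (identityIdem hw g)
  · obtain ⟨U, hU, hFU, hc⟩ :=
      f.2.1.exists_open ((stoneFamily hτ hw).map (Groupoid.inv g) F)
    obtain ⟨y, hFy, hyU⟩ := StoneDual.exists_Z_subset hU hFU
    have key : ∀ F' ∈ StoneDual.Z (identityIdem hw g),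
        ((stoneFamily hτ hw).map (Groupoid.inv g) F' ∈ StoneDual.Z y ↔
          F' ∈ StoneDual.Z (pullIdem hτ hw (Groupoid.inv g) y)) := by
      intro F' hF'
      rw [hZ] at hF'
      simp only [stoneFamily, dif_pos hF']
      exact mem_thetaSet_iff hτ hw (Groupoid.inv g) hF' y
    refine ⟨StoneDual.Z (identityIdem hw g) ∩ StoneDual.Z (pullIdem hτ hw (Groupoid.inv g) y),
      (StoneDual.isOpen_Z _).inter (StoneDual.isOpen_Z _), ⟨hF, (key F hF).1 hFy⟩, ?_⟩
    rintro F' ⟨h1, h2⟩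
    have hd : ∀ F'' ∈ StoneDual.Z (identityIdem hw g), F'' ∈ (stoneFamily hτ hw).dom g :=
      fun _ h => h
    rw [if_pos (hd F' h1), if_pos (hd F hF)]
    exact hc _ (hyU ((key F' h1).2 h2))
  · refine ⟨(StoneDual.Z (identityIdem hw g))ᶜ, (StoneDual.isClosed_Z _).isOpen_compl, hF, ?_⟩
    intro F' hF'
    have hd : ∀ F'' ∉ StoneDual.Z (identityIdem hw g), F'' ∉ (stoneFamily hτ hw).dom g :=
      fun _ h => h
    rw [if_neg (hd F' hF'), if_neg (hd F hF)]

open Classical in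
/-- The family `ρ = (L_c(U_g, K), ρ_g)` on `L_c(X(R), K)`, with `ρ_g(f) = f ∘ θ_{g⁻¹}`; here
`L_c(U_g, K)` is the set of those functions in `L_c(X(R), K)` that vanish outside of `U_g`, that
is, functions on `U_g` are extended by zero. -/
noncomputable def locConstFamily (hτ : IsAlgPartialAction K τ)
    (hw : ∀ {a b : G} (g : a ⟶ b), IsIdentityOf (w g) (τ.dom g)) :
    PartialFamily G (Lc (StoneDual (Idem R)) K) where
  dom g := {f | Function.support f.1 ⊆ (stoneFamily hτ hw).dom g}
  map g f := ⟨fun F => if F ∈ (stoneFamily hτ hw).dom g then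
      f.1 ((stoneFamily hτ hw).map (Groupoid.inv g) F) else 0, pullback_mem_Lc hτ hw g f⟩

end Induced

end PartialFamily

/-! At an ultrafilter `F` every `x : R` acts as a scalar: some `e ∈ F` satisfies `x * e = c • e`.
Elements with this property form a subalgebra containing the idempotents, hence all of `R`, and
torsion-freeness makes `c` unique. So evaluation at `F` is a homomorphism `R → K`, and `φ` sends `x`
to the function `F ↦ c`. Both injectivity and surjectivity of `φ` are local-to-global statements:
the idempotents over which the claim holds form an ideal meeting every ultrafilter, and
`StoneDual.top_mem_of_forall_exists_mem` puts `⊤` in it.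

On the Stone dual, `y ∈ θ_g(F)` means `τ_{g⁻¹}(u_g y) ∈ F` (`stoneFamily_map_mem_iff`), so each
axiom for `θ` becomes a computation with idempotents. Equivariance comes from applying `τ_g` to an
equation `x * e = c • e`. Finally, `ρ` is a partial action because the axioms for `τ` can be carried
along `φ` (`IsEquivariantIso.isAlgPartialAction`). -/

/-! ### Ultrafilters and ideals of a Boolean algebra -/

/-- This is compactness of the Stone dual in algebraic form. A proper ideal extends to a prime
ideal, and the complement of that prime ideal is an ultrafilter disjoint from `S`. -/
theorem StoneDual.top_mem_of_forall_exists_mem {B : Type*} [BooleanAlgebra B] {S : Set B}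
    (lower : IsLowerSet S) (sup : ∀ x ∈ S, ∀ y ∈ S, x ⊔ y ∈ S) (bot : ⊥ ∈ S)
    (h : ∀ F : StoneDual B, ∃ e ∈ F.1, e ∈ S) : ⊤ ∈ S := by
  by_contra htop
  let I : Order.Ideal B := Order.IsIdeal.toIdeal (I := S)
    ⟨lower, ⟨⊥, bot⟩, fun x hx y hy => ⟨x ⊔ y, sup x hx y hy, le_sup_left, le_sup_right⟩⟩
  have hI : ∀ x, x ∈ I ↔ x ∈ S := fun _ => Iff.rfl
  have hdisj : Disjoint ((Order.PFilter.principal (⊤ : B) : Order.PFilter B) : Set B) I := by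
    refine Set.disjoint_left.2 fun x hx hxI => htop ?_
    have hx' : x = ⊤ := top_le_iff.1 (Order.PFilter.mem_principal.1 hx)
    rw [← hx']
    exact hxI
  obtain ⟨J, hJ, hIJ, -⟩ := DistribLattice.prime_ideal_of_disjoint_filter_ideal hdisj
  have htopJ : ⊤ ∉ J := fun h => (Order.Ideal.isProper_iff J).1 hJ.toIsProper (by
    ext x; exact ⟨fun _ => trivial, fun _ => J.lower le_top h⟩)
  let F : StoneDual B := StoneDual.ofSet {x | x ∉ J} htopJ
    (fun x hx y hy hxy => (hJ.mem_or_mem hxy).elim hx hy)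
    (fun x y hxy hx hy => hx (J.lower hxy hy))
    (fun h => h J.bot_mem)
    (fun x => by
      by_contra! hx
      have h1 := Order.Ideal.sup_mem (not_not.1 hx.1) (not_not.1 hx.2)
      rw [sup_compl_eq_top] at h1
      exact htopJ h1)
  obtain ⟨e, heF, heS⟩ := h F
  exact heF (hIJ heS)

/-- Maximality of ultrafilters; it halves every later proof of an identity between the maps `θ_g`.
-/
theorem StoneDual.eq_of_le {B : Type*} [BooleanAlgebra B] {F F' : StoneDual B}
    (h : F.1 ≤ F'.1) : F = F' :=
  Subtype.ext (le_antisymm h (F.2.2 F'.2.1 h))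

/-! ### Evaluation at ultrafilters and the isomorphism `φ` -/

section Character

variable {K : Type*} [CommRing K] {R : Type*} [CommRing R] [Algebra K R]

/-- `c` is the value at `F` of the element `x`: multiplication by some member of `F` turns `x`
into the scalar `c`. -/
def IsValueAt (F : StoneDual (Idem R)) (x : R) (c : K) : Prop :=
  ∃ e ∈ F.1, x * e.1 = c • e.1

namespace IsValueAt

variable {F : StoneDual (Idem R)} {x y : R} {c d : K}

theorem add (hx : IsValueAt F x c) (hy : IsValueAt F y d) : IsValueAt F (x + y) (c + d) := by
  obtain ⟨e, he, h⟩ := hx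
  obtain ⟨f, hf, h'⟩ := hy
  refine ⟨e ⊓ f, Order.PFilter.inf_mem he hf, ?_⟩
  change (x + y) * (e.1 * f.1) = (c + d) • (e.1 * f.1)
  rw [add_mul, add_smul, ← mul_assoc, h, smul_mul_assoc, mul_left_comm, h', mul_smul_comm]

theorem mul (hx : IsValueAt F x c) (hy : IsValueAt F y d) : IsValueAt F (x * y) (c * d) := by
  obtain ⟨e, he, h⟩ := hx
  obtain ⟨f, hf, h'⟩ := hy
  refine ⟨e ⊓ f, Order.PFilter.inf_mem he hf, ?_⟩
  change (x * y) * (e.1 * f.1) = (c * d) • (e.1 * f.1)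
  rw [mul_mul_mul_comm, h, h', smul_mul_smul_comm]

theorem algebraMap (F : StoneDual (Idem R)) (c : K) : IsValueAt F (algebraMap K R c) c :=
  ⟨⊤, Order.PFilter.top_mem, (Algebra.smul_def _ _).symm⟩

theorem one_of_mem {e : Idem R} (he : e ∈ F.1) : IsValueAt F e.1 (1 : K) :=
  ⟨e, he, by rw [one_smul]; exact e.2⟩

theorem zero_of_notMem {e : Idem R} (he : e ∉ F.1) : IsValueAt F e.1 (0 : K) :=
  ⟨eᶜ, F.compl_mem_of_notMem he, by
    change e.1 * (1 - e.1) = _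
    rw [zero_smul, mul_sub, mul_one, e.2.eq, sub_self]⟩

/-- Elements with a value at `F` form a subalgebra, and an idempotent has value 1 or 0 according to
whether it lies in `F`. -/
theorem exists_of_adjoin_eq_top (hgen : Algebra.adjoin K {e : R | IsIdempotentElem e} = ⊤)
    (F : StoneDual (Idem R)) (x : R) : ∃ c : K, IsValueAt F x c := by
  have hx : x ∈ Algebra.adjoin K {e : R | IsIdempotentElem e} := hgen ▸ Algebra.mem_top
  induction hx using Algebra.adjoin_induction with
  | mem e he =>
    by_cases h : (⟨e, he⟩ : Idem R) ∈ F.1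
    · exact ⟨1, one_of_mem h⟩
    · exact ⟨0, zero_of_notMem h⟩
  | algebraMap c => exact ⟨c, IsValueAt.algebraMap F c⟩
  | add x y _ _ hx hy =>
    obtain ⟨c, hc⟩ := hx
    obtain ⟨d, hd⟩ := hy
    exact ⟨c + d, hc.add hd⟩
  | mul x y _ _ hx hy =>
    obtain ⟨c, hc⟩ := hx
    obtain ⟨d, hd⟩ := hy
    exact ⟨c * d, hc.mul hd⟩

/-- Two values `c`, `d` with witnesses `e`, `f` give `(c - d) • (e * f) = 0`, while `e * f` belongs
to `F` and is therefore nonzero. This is where torsion-freeness enters. -/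
theorem unique (htf : ∀ a : K, a ≠ 0 → ∀ e : R, IsIdempotentElem e → e ≠ 0 → a • e ≠ 0)
    (hc : IsValueAt F x c) (hd : IsValueAt F x d) : c = d := by
  obtain ⟨e, he, h⟩ := hc
  obtain ⟨f, hf, h'⟩ := hd
  by_contra hne
  have hef := Order.PFilter.inf_mem he hf
  refine htf (c - d) (sub_ne_zero.2 hne) (e ⊓ f).1 (e ⊓ f).2 (fun h0 => F.2.1 ?_) ?_
  · rwa [show e ⊓ f = ⊥ from Subtype.ext h0] at hef
  · change (c - d) • (e.1 * f.1) = 0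
    rw [sub_smul, ← smul_mul_assoc, ← mul_smul_comm, ← h, ← h']
    ring

end IsValueAt

variable (hgen : Algebra.adjoin K {e : R | IsIdempotentElem e} = ⊤)
  (htf : ∀ a : K, a ≠ 0 → ∀ e : R, IsIdempotentElem e → e ≠ 0 → a • e ≠ 0)

/-- The value at `F` of an element of `R`. -/
noncomputable def stoneValue (F : StoneDual (Idem R)) (x : R) : K :=
  (IsValueAt.exists_of_adjoin_eq_top hgen F x).choose

theorem isValueAt_stoneValue (F : StoneDual (Idem R)) (x : R) :
    IsValueAt F x (stoneValue hgen F x) :=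
  (IsValueAt.exists_of_adjoin_eq_top hgen F x).choose_spec

include htf

variable {hgen} in
theorem stoneValue_eq {F : StoneDual (Idem R)} {x : R} {c : K} (h : IsValueAt F x c) :
    stoneValue hgen F x = c :=
  (isValueAt_stoneValue hgen F x).unique htf h

theorem stoneValue_add (F : StoneDual (Idem R)) (x y : R) :
    stoneValue hgen F (x + y) = stoneValue hgen F x + stoneValue hgen F y :=
  stoneValue_eq htf ((isValueAt_stoneValue hgen F x).add (isValueAt_stoneValue hgen F y))

theorem stoneValue_mul (F : StoneDual (Idem R)) (x y : R) :
    stoneValue hgen F (x * y) = stoneValue hgen F x * stoneValue hgen F y :=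
  stoneValue_eq htf ((isValueAt_stoneValue hgen F x).mul (isValueAt_stoneValue hgen F y))

theorem stoneValue_algebraMap (F : StoneDual (Idem R)) (c : K) :
    stoneValue hgen F (algebraMap K R c) = c :=
  stoneValue_eq htf (IsValueAt.algebraMap F c)

theorem stoneValue_idem (F : StoneDual (Idem R)) (e : Idem R) :
    stoneValue hgen F e.1 = (StoneDual.Z e).indicator (1 : StoneDual (Idem R) → K) F := by
  by_cases h : F ∈ StoneDual.Z e
  · rw [Set.indicator_of_mem h]
    exact stoneValue_eq htf (IsValueAt.one_of_mem h)
  · rw [Set.indicator_of_notMem h]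
    exact stoneValue_eq htf (IsValueAt.zero_of_notMem h)

/-- A witness `e` for the value at `F` is a witness for the same value at every point of `Z e`. -/
theorem isLocallyConstant_stoneValue (x : R) :
    IsLocallyConstant fun F => stoneValue hgen F x := by
  refine StoneDual.isLocallyConstant_of fun F => ?_
  obtain ⟨e, he, h⟩ := isValueAt_stoneValue hgen F x
  exact ⟨StoneDual.Z e, StoneDual.isOpen_Z e, he, fun F' hF' => stoneValue_eq htf ⟨e, hF', h⟩⟩

omit htf in
-- The idempotents annihilating `x` form an ideal. Value 0 at `F` says that this ideal meets `F`, so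
-- it contains 1.
theorem eq_zero_of_stoneValue_eq_zero {x : R} (h : ∀ F, stoneValue hgen F x = 0) : x = 0 := by
  have key : (⊤ : Idem R) ∈ {e : Idem R | x * e.1 = 0} := by
    refine StoneDual.top_mem_of_forall_exists_mem ?_ ?_ (mul_zero x) fun F => ?_
    · intro e f hfe (he : x * e.1 = 0)
      have hf : f.1 * e.1 = f.1 := hfe
      change x * f.1 = 0
      rw [← hf, mul_left_comm, he, mul_zero]
    · intro e (he : x * e.1 = 0) f (hf : x * f.1 = 0)
      change x * (e.1 + f.1 - e.1 * f.1) = 0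
      rw [mul_sub, mul_add, ← mul_assoc, he, hf, zero_mul, add_zero, sub_zero]
    · obtain ⟨e, he, hx⟩ := isValueAt_stoneValue hgen F x
      rw [h F, zero_smul] at hx
      exact ⟨e, he, hx⟩
  exact (mul_one x).symm.trans key

/-- The idempotents `e` for which `f` is realised on `Z e` form an ideal: realisations can be
restricted and glued. Near each point `f` is constant and a scalar realises it. -/
theorem exists_stoneValue_eq {f : StoneDual (Idem R) → K} (hf : IsLocallyConstant f) :
    ∃ x : R, ∀ F, stoneValue hgen F x = f F := by
  have key : (⊤ : Idem R) ∈ {e : Idem R | ∃ x : R, ∀ F ∈ StoneDual.Z e,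
      stoneValue hgen F x = f F} := by
    refine StoneDual.top_mem_of_forall_exists_mem ?_ ?_
      ⟨0, fun F hF => absurd hF F.2.1⟩ fun F => ?_
    · rintro e e' he ⟨x, hx⟩
      exact ⟨x, fun F hF => hx F (Order.PFilter.mem_of_le he hF)⟩
    · rintro e ⟨x, hx⟩ e' ⟨y, hy⟩
      -- The glued element uses `x` on `Z e` and `y` on the rest of `Z (e ⊔ e')`, which lies inside
      -- `Z e'`.
      refine ⟨x * e.1 + y * (eᶜ).1, fun F hF => ?_⟩
      rw [stoneValue_add hgen htf, stoneValue_mul hgen htf, stoneValue_mul hgen htf,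
        stoneValue_idem hgen htf, stoneValue_idem hgen htf]
      by_cases he : e ∈ F.1
      · rw [Set.indicator_of_mem (show F ∈ StoneDual.Z e from he),
          Set.indicator_of_notMem (show F ∉ StoneDual.Z eᶜ from fun h => F.compl_mem_iff.1 h he)]
        simpa using hx F he
      · have hc := F.compl_mem_of_notMem he
        rw [Set.indicator_of_notMem (show F ∉ StoneDual.Z e from he),
          Set.indicator_of_mem (show F ∈ StoneDual.Z eᶜ from hc)]
        have he' : e' ∈ F.1 := by
          refine Order.PFilter.mem_of_le ?_ (Order.PFilter.inf_mem hF hc)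
          change (e ⊔ e') ⊓ eᶜ ≤ e'
          rw [inf_sup_right, inf_compl_self, bot_sup_eq]
          exact inf_le_left
        simpa using hy F he'
    · obtain ⟨U, hU, hFU, hc⟩ := hf.exists_open F
      obtain ⟨e, he, heU⟩ := StoneDual.exists_Z_subset hU hFU
      exact ⟨e, he, algebraMap K R (f F), fun F' hF' =>
        (stoneValue_algebraMap hgen htf F' _).trans (hc F' (heU hF')).symm⟩
  obtain ⟨x, hx⟩ := key
  exact ⟨x, fun F => hx F Order.PFilter.top_mem⟩

/-- The isomorphism of `R` with the locally constant functions on its Stone dual. -/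
noncomputable def stoneRingEquiv : R ≃+* Lc (StoneDual (Idem R)) K :=
  RingEquiv.ofBijective
    ({ toFun := fun x => ⟨fun F => stoneValue hgen F x,
          isLocallyConstant_stoneValue hgen htf x, HasCompactSupport.of_compactSpace _⟩
       map_zero' := Subtype.ext <| funext fun F => by
          simpa using stoneValue_algebraMap hgen htf F 0
       map_add' := fun x y => Subtype.ext <| funext fun F => stoneValue_add hgen htf F x y
       map_mul' := fun x y => Subtype.ext <| funext fun F => stoneValue_mul hgen htf F x y } :
      R →ₙ+* Lc (StoneDual (Idem R)) K)
    ⟨(injective_iff_map_eq_zero _).2 fun _ hx => eq_zero_of_stoneValue_eq_zero hgen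
        fun F => congrFun (congrArg Subtype.val hx) F,
      fun f => by
        obtain ⟨x, hx⟩ := exists_stoneValue_eq hgen htf f.2.1
        exact ⟨x, Subtype.ext (funext hx)⟩⟩

end Character

/-! ### Inverses in partial actions and transport along isomorphisms -/

theorem CategoryTheory.Groupoid.inv_inv' {G : Type u} [Groupoid.{v} G] {a b : G} (g : a ⟶ b) :
    Groupoid.inv (Groupoid.inv g) = g := by
  simp

namespace IsPartialAction

variable {G : Type u} [Groupoid.{v} G] {X : Type*} {α : PartialFamily G X}

theorem map_mem (hα : IsPartialAction α) {a b : G} (g : a ⟶ b) {x : X}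
    (hx : x ∈ α.dom (Groupoid.inv g)) : α.map g x ∈ α.dom g :=
  (hα.bijOn g).mapsTo hx

theorem map_inv_mem (hα : IsPartialAction α) {a b : G} (g : a ⟶ b) {x : X}
    (hx : x ∈ α.dom g) : α.map (Groupoid.inv g) x ∈ α.dom (Groupoid.inv g) :=
  hα.map_mem _ (by rwa [Groupoid.inv_inv'])

theorem map_inv_map (hα : IsPartialAction α) {a b : G} (g : a ⟶ b) {x : X}
    (hx : x ∈ α.dom (Groupoid.inv g)) : α.map (Groupoid.inv g) (α.map g x) = x := by
  have hg : α.map g x ∈ α.dom g := hα.map_mem g hx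
  rw [hα.map_comp g (Groupoid.inv g) x hx ⟨by rwa [Groupoid.inv_inv'], hg⟩, Groupoid.comp_inv]
  exact hα.map_id a x (hα.dom_subset _ hx)

theorem map_map_inv (hα : IsPartialAction α) {a b : G} (g : a ⟶ b) {x : X}
    (hx : x ∈ α.dom g) : α.map g (α.map (Groupoid.inv g) x) = x := by
  have h := hα.map_inv_map (Groupoid.inv g) (x := x) (by rwa [Groupoid.inv_inv'])
  rwa [Groupoid.inv_inv'] at h

end IsPartialAction

/-- Every element of `B` is some `φ x`, and equivariance turns each axiom for `β` into the same
axiom for `α`. Thus `ρ` needs no direct verification on functions. -/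
theorem IsEquivariantIso.isAlgPartialAction {K : Type*} [CommRing K] {G : Type u}
    [Groupoid.{v} G] {A B : Type*} [NonUnitalRing A] [Module K A] [NonUnitalRing B] [Module K B]
    {α : PartialFamily G A} {β : PartialFamily G B} {φ : A ≃+* B}
    (hφ : IsEquivariantIso K α β φ) (hα : IsAlgPartialAction K α) : IsAlgPartialAction K β := by
  have hdom : ∀ {a b : G} (g : a ⟶ b) (x : A), φ x ∈ β.dom g ↔ x ∈ α.dom g := by
    intro a b g x
    rw [← hφ.image_dom]
    exact φ.injective.mem_set_image
  -- The ambient sets are left general to cover both ideals of the whole algebra and ideals of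
  -- `D_{r(g)}`.
  have hideal : ∀ {a b : G} (g : a ⟶ b) {J : Set A} {J' : Set B}, (∀ x, φ x ∈ J' ↔ x ∈ J) →
      IsIdealOf K (α.dom g) J → IsIdealOf K (β.dom g) J' := by
    intro a b g J J' hJ h
    constructor
    · intro y hy
      obtain ⟨x, rfl⟩ := φ.surjective y
      exact (hJ x).2 (h.subset ((hdom g x).1 hy))
    · rw [← map_zero φ, hdom]
      exact h.zero_mem
    · intro y hy z hz
      obtain ⟨x, rfl⟩ := φ.surjective y
      obtain ⟨x', rfl⟩ := φ.surjective z
      rw [hdom] at hy hz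
      rw [← map_add, hdom]
      exact h.add_mem x hy x' hz
    · intro r y hy
      obtain ⟨x, rfl⟩ := φ.surjective y
      rw [hdom] at hy
      rw [← hφ.map_smul, hdom]
      exact h.smul_mem r x hy
    · intro y hy z hz
      obtain ⟨x, rfl⟩ := φ.surjective y
      obtain ⟨x', rfl⟩ := φ.surjective z
      rw [hdom] at hy
      rw [hJ] at hz
      rw [← map_mul, ← map_mul, hdom, hdom]
      exact h.mul_mem x hy x' hz
  have hbij : ∀ {a b : G} (g : a ⟶ b),
      Set.BijOn (β.map g) (β.dom (Groupoid.inv g)) (β.dom g) := by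
    intro a b g
    refine ⟨?_, ?_, ?_⟩
    · intro y hy
      obtain ⟨x, rfl⟩ := φ.surjective y
      rw [hdom] at hy
      rw [← hφ.map_map g x hy, hdom]
      exact (hα.bijOn g).mapsTo hy
    · intro y hy z hz h
      obtain ⟨x, rfl⟩ := φ.surjective y
      obtain ⟨x', rfl⟩ := φ.surjective z
      rw [hdom] at hy hz
      rw [← hφ.map_map g x hy, ← hφ.map_map g x' hz] at h
      rw [(hα.bijOn g).injOn hy hz (φ.injective h)]
    · intro y hy
      obtain ⟨x, rfl⟩ := φ.surjective y
      rw [hdom] at hy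
      obtain ⟨x', hx', rfl⟩ := (hα.bijOn g).surjOn hy
      exact ⟨φ x', (hdom _ _).2 hx', (hφ.map_map g x' hx').symm⟩
  refine { bijOn := hbij, dom_subset := ?_, map_id := ?_, dom_comp := ?_, map_comp := ?_,
           ideal_id := ?_, ideal_dom := ?_, map_add := ?_, map_mul := ?_, map_smul := ?_ }
  · intro a b g y hy
    obtain ⟨x, rfl⟩ := φ.surjective y
    rw [hdom] at hy ⊢
    exact hα.dom_subset g hy
  · intro e y hy
    obtain ⟨x, rfl⟩ := φ.surjective y
    rw [hdom] at hy
    rw [← hφ.map_map (𝟙 e) x (by rwa [Groupoid.inv_eq_inv, IsIso.inv_id]), hα.map_id e x hy]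
  · intro a b c h g y hy hy'
    obtain ⟨x, rfl⟩ := φ.surjective y
    rw [hdom] at hy ⊢
    rw [← hφ.map_map h x hy, Set.mem_inter_iff, hdom, hdom] at hy'
    exact hα.dom_comp h g x hy hy'
  · intro a b c h g y hy hy'
    obtain ⟨x, rfl⟩ := φ.surjective y
    rw [hdom] at hy
    rw [← hφ.map_map h x hy, Set.mem_inter_iff, hdom, hdom] at hy'
    rw [← hφ.map_map h x hy, ← hφ.map_map g _ hy'.1, hα.map_comp h g x hy hy',
      hφ.map_map _ x (hα.dom_comp h g x hy hy')]
  · exact fun e => hideal _ (fun _ => Iff.rfl) (hα.ideal_id e)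
  · exact fun {a b} g => hideal g (hdom (𝟙 b)) (hα.ideal_dom g)
  · intro a b g y hy z hz
    obtain ⟨x, rfl⟩ := φ.surjective y
    obtain ⟨x', rfl⟩ := φ.surjective z
    rw [hdom] at hy hz
    rw [← map_add, ← hφ.map_map g x hy, ← hφ.map_map g x' hz,
      ← hφ.map_map g _ ((hα.ideal_dom _).add_mem x hy x' hz), hα.map_add g x hy x' hz, map_add]
  · intro a b g y hy z hz
    obtain ⟨x, rfl⟩ := φ.surjective y
    obtain ⟨x', rfl⟩ := φ.surjective z
    rw [hdom] at hy hz
    rw [← map_mul, ← hφ.map_map g x hy, ← hφ.map_map g x' hz,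
      ← hφ.map_map g _ ((hα.ideal_dom _).mul_mem x hy x' ((hα.ideal_dom _).subset hz)).1,
      hα.map_mul g x hy x' hz, map_mul]
  · intro a b g r y hy
    obtain ⟨x, rfl⟩ := φ.surjective y
    rw [hdom] at hy
    rw [← hφ.map_smul, ← hφ.map_map g x hy, ← hφ.map_map g _ ((hα.ideal_dom _).smul_mem r x hy),
      hα.map_smul g r x hy, hφ.map_smul]

/-! ### The topological partial action `θ` -/

namespace PartialFamily

variable {K : Type*} [CommRing K] {R : Type*} [CommRing R] [Algebra K R]
  {G : Type u} [Groupoid.{v} G] {τ : PartialFamily G R} {w : ∀ {a b : G}, (a ⟶ b) → R}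

theorem mem_dom_iff (hτ : IsAlgPartialAction K τ)
    (hw : ∀ {a b : G} (g : a ⟶ b), IsIdentityOf (w g) (τ.dom g)) {a b : G} (g : a ⟶ b) {x : R} :
    x ∈ τ.dom g ↔ w g * x = x :=
  ⟨(hw g).mul_left x, fun h => h ▸ identity_mul_mem hτ hw g x⟩

/-- The idempotent `τ_g(z)`, for an idempotent `z` of `D_{g⁻¹}`. -/
def pushIdem (hτ : IsAlgPartialAction K τ) {a b : G} (g : a ⟶ b) (z : Idem R)
    (hz : z.1 ∈ τ.dom (Groupoid.inv g)) : Idem R :=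
  ⟨τ.map g z.1, by rw [IsIdempotentElem, ← hτ.map_mul g _ hz _ hz, z.2.eq]⟩

/-- The working description of `θ_g(F)`: it replaces the upward closure by a single membership in
`F`. -/
theorem stoneFamily_map_mem_iff (hτ : IsAlgPartialAction K τ)
    (hw : ∀ {a b : G} (g : a ⟶ b), IsIdentityOf (w g) (τ.dom g)) {a b : G} (g : a ⟶ b)
    {F : StoneDual (Idem R)} (hF : F ∈ (stoneFamily hτ hw).dom (Groupoid.inv g)) (y : Idem R) :
    y ∈ ((stoneFamily hτ hw).map g F).1 ↔ pullIdem hτ hw g y ∈ F.1 := by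
  change F ∈ StoneDual.Z _ at hF
  simp only [stoneFamily, dif_pos hF]
  exact mem_thetaSet_iff hτ hw g hF y

/-- Pulling `τ_g(z)` back by `τ_{g⁻¹}` returns `z`. -/
theorem pushIdem_mem_stoneFamily_map_iff (hτ : IsAlgPartialAction K τ)
    (hw : ∀ {a b : G} (g : a ⟶ b), IsIdentityOf (w g) (τ.dom g)) {a b : G} (g : a ⟶ b)
    {F : StoneDual (Idem R)} (hF : F ∈ (stoneFamily hτ hw).dom (Groupoid.inv g)) (z : Idem R)
    (hz : z.1 ∈ τ.dom (Groupoid.inv g)) :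
    pushIdem hτ g z hz ∈ ((stoneFamily hτ hw).map g F).1 ↔ z ∈ F.1 := by
  rw [stoneFamily_map_mem_iff hτ hw g hF]
  have h : pullIdem hτ hw g (pushIdem hτ g z hz) = z := Subtype.ext (by
    change τ.map (Groupoid.inv g) (w g * τ.map g z.1) = z.1
    rw [(hw g).mul_left _ (hτ.map_mem g hz), hτ.map_inv_map g hz])
  rw [h]

theorem mem_stoneFamily_dom_of_mem (hτ : IsAlgPartialAction K τ)
    (hw : ∀ {a b : G} (g : a ⟶ b), IsIdentityOf (w g) (τ.dom g)) {a b : G} (g : a ⟶ b)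
    {F : StoneDual (Idem R)} {z : Idem R} (hz : z.1 ∈ τ.dom g) (hF : z ∈ F.1) :
    F ∈ (stoneFamily hτ hw).dom g :=
  Order.PFilter.mem_of_le (show z.1 * w g = z.1 from (hw g).mul_right _ hz) hF

theorem stoneFamily_map_mem_dom (hτ : IsAlgPartialAction K τ)
    (hw : ∀ {a b : G} (g : a ⟶ b), IsIdentityOf (w g) (τ.dom g)) {a b : G} (g : a ⟶ b)
    {F : StoneDual (Idem R)} (hF : F ∈ (stoneFamily hτ hw).dom (Groupoid.inv g)) :
    (stoneFamily hτ hw).map g F ∈ (stoneFamily hτ hw).dom g :=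
  mem_stoneFamily_dom_of_mem hτ hw g (hτ.map_mem g (hw (Groupoid.inv g)).mem)
    ((pushIdem_mem_stoneFamily_map_iff hτ hw g hF (identityIdem hw (Groupoid.inv g))
      (hw (Groupoid.inv g)).mem).2 hF)

theorem stoneFamily_map_inv_map (hτ : IsAlgPartialAction K τ)
    (hw : ∀ {a b : G} (g : a ⟶ b), IsIdentityOf (w g) (τ.dom g)) {a b : G} (g : a ⟶ b)
    {F : StoneDual (Idem R)} (hF : F ∈ (stoneFamily hτ hw).dom (Groupoid.inv g)) :
    (stoneFamily hτ hw).map (Groupoid.inv g) ((stoneFamily hτ hw).map g F) = F := by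
  symm
  refine StoneDual.eq_of_le fun y hy => ?_
  have hm := stoneFamily_map_mem_dom hτ hw g hF
  have hmem : w (Groupoid.inv g) * y.1 ∈ τ.dom (Groupoid.inv g) := identity_mul_mem hτ hw _ _
  change y ∈ ((stoneFamily hτ hw).map (Groupoid.inv g) ((stoneFamily hτ hw).map g F)).1
  rw [stoneFamily_map_mem_iff hτ hw _ (by rwa [Groupoid.inv_inv'])]
  -- Pulling back along `g⁻¹` is pushing forward along `g`, once `y` is cut down by `u_{g⁻¹}`.
  have h : pullIdem hτ hw (Groupoid.inv g) y =
      pushIdem hτ g (identityIdem hw (Groupoid.inv g) ⊓ y) hmem := Subtype.ext (by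
    change τ.map (Groupoid.inv (Groupoid.inv g)) _ = τ.map g _
    rw [Groupoid.inv_inv']
    rfl)
  rw [h]
  exact (pushIdem_mem_stoneFamily_map_iff hτ hw g hF _ hmem).2 (Order.PFilter.inf_mem hF hy)

theorem stoneFamily_map_map_inv (hτ : IsAlgPartialAction K τ)
    (hw : ∀ {a b : G} (g : a ⟶ b), IsIdentityOf (w g) (τ.dom g)) {a b : G} (g : a ⟶ b)
    {F : StoneDual (Idem R)} (hF : F ∈ (stoneFamily hτ hw).dom g) :
    (stoneFamily hτ hw).map g ((stoneFamily hτ hw).map (Groupoid.inv g) F) = F := by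
  have h := stoneFamily_map_inv_map hτ hw (Groupoid.inv g) (F := F) (by rwa [Groupoid.inv_inv'])
  rwa [Groupoid.inv_inv'] at h

theorem stoneFamily_map_inv_mem_dom (hτ : IsAlgPartialAction K τ)
    (hw : ∀ {a b : G} (g : a ⟶ b), IsIdentityOf (w g) (τ.dom g)) {a b : G} (g : a ⟶ b)
    {F : StoneDual (Idem R)} (hF : F ∈ (stoneFamily hτ hw).dom g) :
    (stoneFamily hτ hw).map (Groupoid.inv g) F ∈ (stoneFamily hτ hw).dom (Groupoid.inv g) :=
  stoneFamily_map_mem_dom hτ hw _ (by rwa [Groupoid.inv_inv'])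

/-- The compatibility of two consecutive maps `θ_h` and `θ_g`: on their common domain, a member of
`θ_g(θ_h(F))` is above the image `τ_{gh}(z)` of a member `z` of `F`. -/
theorem exists_mem_of_mem_stoneFamily_map_map (hτ : IsAlgPartialAction K τ)
    (hw : ∀ {a b : G} (g : a ⟶ b), IsIdentityOf (w g) (τ.dom g)) {a b c : G} (h : a ⟶ b)
    (g : b ⟶ c) {F : StoneDual (Idem R)} (hF : F ∈ (stoneFamily hτ hw).dom (Groupoid.inv h))
    (hF' : (stoneFamily hτ hw).map h F ∈ (stoneFamily hτ hw).dom (Groupoid.inv g)) {y : Idem R}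
    (hy : y ∈ ((stoneFamily hτ hw).map g ((stoneFamily hτ hw).map h F)).1) :
    ∃ (z : Idem R) (hz : z.1 ∈ τ.dom (Groupoid.inv (h ≫ g))), z ∈ F.1 ∧
      pushIdem hτ (h ≫ g) z hz ≤ y := by
  -- With `p = τ_{g⁻¹}(u_g y)`, this says that `z = τ_{h⁻¹}(u_h p)` lies in `F`. Since `τ_h(z) = u_h
  -- p` lies in both `D_h` and `D_{g⁻¹}`, the composition axioms for `τ` apply to `z`.
  rw [stoneFamily_map_mem_iff hτ hw g hF', stoneFamily_map_mem_iff hτ hw h hF] at hy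
  have hm : w g * y.1 ∈ τ.dom g := identity_mul_mem hτ hw g _
  have hp : (pullIdem hτ hw g y).1 ∈ τ.dom (Groupoid.inv g) := hτ.map_inv_mem g hm
  have hq : w h * (pullIdem hτ hw g y).1 ∈ τ.dom h := identity_mul_mem hτ hw h _
  have hq' : w h * (pullIdem hτ hw g y).1 ∈ τ.dom (Groupoid.inv g) := by
    rw [mem_dom_iff hτ hw, mul_left_comm, (hw (Groupoid.inv g)).mul_left _ hp]
  have hz : (pullIdem hτ hw h (pullIdem hτ hw g y)).1 ∈ τ.dom (Groupoid.inv h) :=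
    hτ.map_inv_mem h hq
  have hh : τ.map h (pullIdem hτ hw h (pullIdem hτ hw g y)).1
      = w h * (pullIdem hτ hw g y).1 := hτ.map_map_inv h hq
  have hI : τ.map h (pullIdem hτ hw h (pullIdem hτ hw g y)).1
      ∈ τ.dom (Groupoid.inv g) ∩ τ.dom h := by
    rw [hh]
    exact ⟨hq', hq⟩
  refine ⟨_, hτ.dom_comp h g _ hz hI, hy, ?_⟩
  change τ.map (h ≫ g) _ * y.1 = τ.map (h ≫ g) _
  have hgy : τ.map g (pullIdem hτ hw g y).1 = w g * y.1 := hτ.map_map_inv g hm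
  -- Splitting off a second factor `p` makes `τ_{gh}(z)` a multiple of `τ_g(p) = u_g y`, which
  -- absorbs `y`.
  have hsplit : w h * (pullIdem hτ hw g y).1
      = w h * (pullIdem hτ hw g y).1 * (pullIdem hτ hw g y).1 := by
    rw [mul_assoc, (pullIdem hτ hw g y).2.eq]
  rw [← hτ.map_comp h g _ hz hI, hh, hsplit, hτ.map_mul g _ hq' _ hp, hgy, mul_assoc, mul_assoc,
    y.2.eq]

theorem isPartialAction_stoneFamily (hτ : IsAlgPartialAction K τ)
    (hw : ∀ {a b : G} (g : a ⟶ b), IsIdentityOf (w g) (τ.dom g)) :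
    IsPartialAction (stoneFamily hτ hw) where
  bijOn g := ⟨fun _ hF => stoneFamily_map_mem_dom hτ hw g hF,
    fun F hF F' hF' h => by
      rw [← stoneFamily_map_inv_map hτ hw g hF, h, stoneFamily_map_inv_map hτ hw g hF'],
    fun F hF => ⟨_, stoneFamily_map_inv_mem_dom hτ hw g hF, stoneFamily_map_map_inv hτ hw g hF⟩⟩
  dom_subset g _ hF := mem_stoneFamily_dom_of_mem hτ hw _ (z := identityIdem hw g)
    (hτ.dom_subset g (hw g).mem) hF
  map_id e F hF := by
    have hinv : Groupoid.inv (𝟙 e) = 𝟙 e := by simp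
    refine StoneDual.eq_of_le fun y hy => ?_
    change y ∈ ((stoneFamily hτ hw).map (𝟙 e) F).1 at hy
    rw [stoneFamily_map_mem_iff hτ hw _ (by rwa [hinv])] at hy
    refine Order.PFilter.mem_of_le ?_ hy
    change τ.map (Groupoid.inv (𝟙 e)) (w (𝟙 e) * y.1) * y.1
      = τ.map (Groupoid.inv (𝟙 e)) (w (𝟙 e) * y.1)
    rw [hinv, hτ.map_id e _ (identity_mul_mem hτ hw _ _), mul_assoc, y.2.eq]
  -- Taking `y = ⊤` suffices: any member of `F` in the domain of `τ_{gh}` puts `F` in the domain of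
  -- `θ_{gh}`.
  dom_comp h g F hF hF' := by
    obtain ⟨z, hz, hzF, -⟩ :=
      exists_mem_of_mem_stoneFamily_map_map hτ hw h g hF hF'.1 Order.PFilter.top_mem
    exact mem_stoneFamily_dom_of_mem hτ hw _ hz hzF
  map_comp h g F hF hF' := by
    refine StoneDual.eq_of_le fun y hy => ?_
    obtain ⟨z, hz, hzF, hzy⟩ :=
      exists_mem_of_mem_stoneFamily_map_map hτ hw h g hF hF'.1 hy
    exact Order.PFilter.mem_of_le hzy ((pushIdem_mem_stoneFamily_map_iff hτ hw _
      (mem_stoneFamily_dom_of_mem hτ hw _ hz hzF) z hz).2 hzF)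

/-- On the domain of `θ_g`, the preimage of `Z y` is the trace of `Z (τ_{g⁻¹}(u_g y))`. -/
theorem continuousOn_stoneFamily_map (hτ : IsAlgPartialAction K τ)
    (hw : ∀ {a b : G} (g : a ⟶ b), IsIdentityOf (w g) (τ.dom g)) {a b : G} (g : a ⟶ b) :
    ContinuousOn ((stoneFamily hτ hw).map g) ((stoneFamily hτ hw).dom (Groupoid.inv g)) := by
  rw [continuousOn_iff_continuous_domRestrict]
  refine continuous_generateFrom_iff.2 ?_
  rintro _ ⟨y, rfl⟩
  have h : ((stoneFamily hτ hw).dom (Groupoid.inv g)).domRestrict ((stoneFamily hτ hw).map g) ⁻¹'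
      StoneDual.Z y = Subtype.val ⁻¹' StoneDual.Z (pullIdem hτ hw g y) :=
    Set.ext fun F => stoneFamily_map_mem_iff hτ hw g F.2 y
  rw [h]
  exact (StoneDual.isOpen_Z _).preimage continuous_subtype_val

theorem isTopologicalPartialAction_stoneFamily (hτ : IsAlgPartialAction K τ)
    (hw : ∀ {a b : G} (g : a ⟶ b), IsIdentityOf (w g) (τ.dom g)) :
    IsTopologicalPartialAction (stoneFamily hτ hw) where
  toIsPartialAction := isPartialAction_stoneFamily hτ hw
  isOpen_dom _ := StoneDual.isOpen_Z _
  isHomeomorph g := by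
    refine isHomeomorph_iff_exists_inverse.2
      ⟨(continuousOn_stoneFamily_map hτ hw g).mapsToRestrict _,
        Set.MapsTo.restrict ((stoneFamily hτ hw).map (Groupoid.inv g)) _ _
          fun _ hF => stoneFamily_map_inv_mem_dom hτ hw g hF,
        fun F => Subtype.ext (stoneFamily_map_inv_map hτ hw g F.2),
        fun F => Subtype.ext (stoneFamily_map_map_inv hτ hw g F.2),
        ContinuousOn.mapsToRestrict ?_ _⟩
    have h := continuousOn_stoneFamily_map hτ hw (Groupoid.inv g)
    rwa [Groupoid.inv_inv'] at h

/-! ### Equivariance of `φ` -/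

theorem isEquivariantIso_stoneRingEquiv (hτ : IsAlgPartialAction K τ)
    (hw : ∀ {a b : G} (g : a ⟶ b), IsIdentityOf (w g) (τ.dom g))
    (hgen : Algebra.adjoin K {e : R | IsIdempotentElem e} = ⊤)
    (htf : ∀ a : K, a ≠ 0 → ∀ e : R, IsIdempotentElem e → e ≠ 0 → a • e ≠ 0) :
    IsEquivariantIso K τ (locConstFamily hτ hw) (stoneRingEquiv hgen htf) := by
  have hsupp : ∀ {a b : G} (g : a ⟶ b) {x : R}, x ∈ τ.dom g →
      ∀ F ∉ (stoneFamily hτ hw).dom g, stoneValue hgen F x = 0 := by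
    intro a b g x hx F hF
    have h0 := stoneValue_idem hgen htf F (identityIdem hw g)
    rw [Set.indicator_of_notMem (show F ∉ StoneDual.Z (identityIdem hw g) from hF)] at h0
    change stoneValue hgen F (w g) = 0 at h0
    rw [← (hw g).mul_left x hx, stoneValue_mul hgen htf, h0, zero_mul]
  refine ⟨fun r x => Subtype.ext (funext fun F => ?_), fun {a b} g => ?_, fun {a b} g x hx => ?_⟩
  · change stoneValue hgen F (r • x) = r • stoneValue hgen F x
    rw [Algebra.smul_def, stoneValue_mul hgen htf, stoneValue_algebraMap hgen htf, smul_eq_mul]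
  · ext f
    constructor
    · rintro ⟨x, hx, rfl⟩ F hF
      by_contra h
      exact hF (hsupp g hx F h)
    · intro (hf : Function.support f.1 ⊆ (stoneFamily hτ hw).dom g)
      obtain ⟨x, rfl⟩ := (stoneRingEquiv hgen htf).surjective f
      -- Since `u_g` has value 1 on `U_g` and the values of `x` vanish elsewhere, `u_g x` and `x`
      -- have equal values everywhere; hence `u_g x = x`.
      refine ⟨x, (mem_dom_iff hτ hw g).2 ((stoneRingEquiv hgen htf).injective ?_), rfl⟩
      refine Subtype.ext (funext fun F => ?_)
      change stoneValue hgen F (w g * x) = stoneValue hgen F x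
      rw [stoneValue_mul hgen htf]
      by_cases hF : F ∈ (stoneFamily hτ hw).dom g
      · have h1 := stoneValue_idem hgen htf F (identityIdem hw g)
        rw [Set.indicator_of_mem (show F ∈ StoneDual.Z (identityIdem hw g) from hF)] at h1
        change stoneValue hgen F (w g) = 1 at h1
        rw [h1, one_mul]
      · have h0 : stoneValue hgen F x = 0 := Function.notMem_support.1 fun h => hF (hf h)
        rw [h0, mul_zero]
  · refine Subtype.ext (funext fun F => ?_)
    change stoneValue hgen F (τ.map g x) = _
    by_cases hF : F ∈ (stoneFamily hτ hw).dom g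
    · refine (stoneValue_eq htf ?_).trans (if_pos hF).symm
      obtain ⟨e, he, hxe⟩ := isValueAt_stoneValue hgen
        ((stoneFamily hτ hw).map (Groupoid.inv g) F) x
      rw [stoneFamily_map_mem_iff hτ hw _ (by rwa [Groupoid.inv_inv'])] at he
      -- If `x * e = c • e` with `e ∈ θ_{g⁻¹}(F)`, then `τ_g(u_{g⁻¹} e)` lies in `F`. Applying `τ_g`
      -- to the equation multiplied by `u_{g⁻¹}` shows that it witnesses the value `c` of `τ_g(x)`
      -- at `F`.
      refine ⟨_, he, ?_⟩
      change τ.map g x * τ.map (Groupoid.inv (Groupoid.inv g)) (w (Groupoid.inv g) * e.1)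
        = stoneValue hgen _ x • τ.map (Groupoid.inv (Groupoid.inv g)) (w (Groupoid.inv g) * e.1)
      have hm : w (Groupoid.inv g) * e.1 ∈ τ.dom (Groupoid.inv g) := identity_mul_mem hτ hw _ _
      rw [Groupoid.inv_inv', ← hτ.map_mul g _ hx _ hm, ← hτ.map_smul g _ _ hm, mul_left_comm, hxe,
        mul_smul_comm]
    · exact (hsupp g (hτ.map_mem g hx) F hF).trans (if_neg hF).symm

end PartialFamily

theorem mainTheorem11 {K : Type*} [CommRing K] {R : Type*} [CommRing R] [Algebra K R]
    (hgen : Algebra.adjoin K {e : R | IsIdempotentElem e} = ⊤)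
    (htf : ∀ a : K, a ≠ 0 → ∀ e : R, IsIdempotentElem e → e ≠ 0 → a • e ≠ 0)
    {G : Type u} [Groupoid.{v} G] (τ : PartialFamily G R) (hτ : IsAlgPartialAction K τ)
    (w : ∀ {a b : G}, (a ⟶ b) → R)
    (hw : ∀ {a b : G} (g : a ⟶ b), IsIdentityOf (w g) (τ.dom g)) :
    IsTopologicalPartialAction (PartialFamily.stoneFamily hτ hw) ∧
    IsAlgPartialAction K (PartialFamily.locConstFamily hτ hw) ∧
    ∃ φ : R ≃+* Lc (StoneDual (Idem R)) K,
      IsEquivariantIso K τ (PartialFamily.locConstFamily hτ hw) φ ∧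
      ∀ e : Idem R, (φ e.1).1 = (StoneDual.Z e).indicator 1 := by
  have h := PartialFamily.isEquivariantIso_stoneRingEquiv hτ hw hgen htf
  exact ⟨PartialFamily.isTopologicalPartialAction_stoneFamily hτ hw, h.isAlgPartialAction hτ,
    stoneRingEquiv hgen htf, h, fun e => funext fun F => stoneValue_idem hgen htf F e⟩
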